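/- **Lemma 3 (Asymptotic weighted $\ell_p$-distortion).** Let $\sigma_0>0$, let $\varphi_0(t)=(2\pi\sigma_0^2)^{-1/2}e^{-t^2/(2\sigma_0^2)}$ be the $\mathcal N(0,\sigma_0^2)$ density, and write $|||f|||_q:=\big(\int_{\mathbb R}|f(t)|^q\,dt\big)^{1/q}$. Let $\mathcal G:\mathbb R\to(0,1)$ be the compressor $$\mathcal G(\lambda)=\int_{-\infty}^{\lambda}\mathcal G'(t)\,dt,\qquad \mathcal G'(t)=\Big[\int_{\mathbb R}\varphi_0^{1/3}(s)\,ds\Big]^{-1}\varphi_0^{1/3}(t).$$ For a number of bits $B\in\mathbb N$ and $1\le k\le 2^B$, let $\mathcal R_k=[t_k,t_{k+1})\cap\mathbb R$ be the bin with thresholds given by $\mathcal G(t_k)=(k-1)2^{-B}$ (so $t_1=-\infty$ and $t_{2^B+1}=+\infty$). For an integer $p\ge2$ let the $p$-optimal level $\omega_{k,p}$ be the minimizer of $\lambda\mapsto\int_{\mathcal R_k}|t-\lambda|^p\varphi_0(t)\,dt$ over $\lambda\in\mathcal R_k$, and let $\mathcal Q_p[t]=\omega_{k,p}$ for $t\in\mathcal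 R_k$. Let $z_1,z_2,\dots$ be i.i.d. $\mathcal N(0,\sigma_0^2)$ random variables and let $\boldsymbol z=(z_1,\dots,z_M)$. Put $w_i=\mathcal G'(\mathcal Q_p[z_i])^{(p-2)/p}$ and $\|\boldsymbol v\|_{p,\boldsymbol w}=\|\mathrm{diag}(\boldsymbol w)\boldsymbol v\|_p=\big(\sum_{i=1}^M|w_iv_i|^p\big)^{1/p}$, with $\mathcal Q_p$ applied entrywise to $\boldsymbol z$. Then, almost surely, $$\|\mathcal Q_p[\boldsymbol z]-\boldsymbol z\|_{p,\boldsymbol w}^p\ \simeq\ M\,\frac{2^{-Bp}}{(p+1)\,2^p}\,|||\varphi_0|||_{1/3}$$ as first $M\to\infty$ and then $B\to\infty$. That is, there are deterministic numbers $r(B)$ with $\lim_{B\to\infty}r(B)=1$ such that, almost surely, for every $B$ the quotient of the left-hand side by the right-hand side converges to $r(B)$ as $M\to\infty$. Moreover, $|||\varphi_0|||_{1/3}=2\pi\sigma_0^2\,3^{3/2}$. -/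

import Mathlib

open Filter Topology MeasureTheory ProbabilityTheory
open scoped NNReal ENNReal

noncomputable section

namespace GaussianQuantization

/-- The functional `|||f|||_q = (∫ |f(t)|^q dt)^(1/q)`, for `f : ℝ → ℝ` and `0 < q < ∞`. -/
def fnorm (q : ℝ) (f : ℝ → ℝ) : ℝ := (∫ t, |f t| ^ q) ^ (1 / q)

/-- The pdf `φ₀` of `N(0, σ₀²)`. -/
def pdf (σ₀ : ℝ≥0) : ℝ → ℝ := gaussianPDFReal 0 (σ₀ ^ 2)

/-- The quantizer point density function `G' = φ₀^(1/3) / ∫ φ₀^(1/3)`. -/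
def qpdf (σ₀ : ℝ≥0) (x : ℝ) : ℝ :=
  (∫ t, pdf σ₀ t ^ (1 / 3 : ℝ))⁻¹ * pdf σ₀ x ^ (1 / 3 : ℝ)

/-- The optimal compressor `G : ℝ → (0, 1)`, the primitive of `G'` that vanishes at `-∞`. -/
def compressor (σ₀ : ℝ≥0) (x : ℝ) : ℝ := ∫ t in Set.Iic x, qpdf σ₀ t

/-- The `k`-th bin (`k = 0, …, 2 ^ B - 1`) of the `B`-bit compander: the preimage under the
increasing function `G` of the `k`-th cell `[k 2^(-B), (k+1) 2^(-B))` of the uniform quantizer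
of `[0, 1]`. It is the interval between the consecutive thresholds `G⁻¹(k 2^(-B))` and
`G⁻¹((k+1) 2^(-B))`, the first and last thresholds being `-∞` and `+∞`. -/
def bin (σ₀ : ℝ≥0) (B k : ℕ) : Set ℝ :=
  {t | (k : ℝ) / 2 ^ B ≤ compressor σ₀ t ∧ compressor σ₀ t < ((k : ℝ) + 1) / 2 ^ B}

/-- The `p`-th power distortion of the `k`-th bin when it is represented by the value `x`. -/
def binDistortion (σ₀ : ℝ≥0) (p B k : ℕ) (x : ℝ) : ℝ :=
  ∫ t in bin σ₀ B k, |t - x| ^ p * pdf σ₀ t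

/-- The `p`-optimal level of the `k`-th bin: the point of the bin that minimizes the
`p`-th power distortion over the bin. -/
def level (σ₀ : ℝ≥0) (p B k : ℕ) : ℝ :=
  Classical.epsilon fun x : ℝ =>
    x ∈ bin σ₀ B k ∧ IsMinOn (binDistortion σ₀ p B k) (bin σ₀ B k) x

/-- The quantizer `Q_p`: its value on the `k`-th bin is the `p`-optimal level of this bin
(the bins with `k < 2 ^ B` form a partition of `ℝ`). -/
def quantizer (σ₀ : ℝ≥0) (p B : ℕ) (t : ℝ) : ℝ :=
  ∑ k ∈ Finset.range (2 ^ B), (bin σ₀ B k).indicator (fun _ => level σ₀ p B k) t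

/-- The weighted norm `‖v‖_{p,w} = ‖diag(w) v‖_p` on `ℝ^M`. -/
def weightedNorm {M : ℕ} (p : ℕ) (w v : Fin M → ℝ) : ℝ :=
  ‖WithLp.toLp (p : ℝ≥0∞) (fun i => w i * v i)‖

/-- The weights `w_i = G'(Q_p[z_i])^((p-2)/p)` of a vector `z ∈ ℝ^M`. -/
def weights {M : ℕ} (σ₀ : ℝ≥0) (p B : ℕ) (z : Fin M → ℝ) : Fin M → ℝ :=
  fun i => qpdf σ₀ (quantizer σ₀ p B (z i)) ^ (((p : ℝ) - 2) / p)

/-- The weighted distortion `‖Q_p[z] - z‖_{p,w}^p` of a vector `z ∈ ℝ^M`. -/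
def weightedDistortion {M : ℕ} (σ₀ : ℝ≥0) (p B : ℕ) (z : Fin M → ℝ) : ℝ :=
  weightedNorm p (weights σ₀ p B z) (fun i => quantizer σ₀ p B (z i) - z i) ^ p

end GaussianQuantization

end

namespace GaussianQuantization

/-! The cube root of a Gaussian density is again Gaussian up to a factor, with three times the
variance. So `G'` is the density of `ν = N(0, 3σ₀²)`, and `φ₀ = A G'^3` with `A = |||φ₀|||_{1/3}`
(`pdf_eq`, `fnorm_pdf`).

For fixed `B` the weighted distortion is a sum of i.i.d. integrable terms, and the strong law gives
`1/M` times it the almost sure limit `∑ k, cellDistortion σ₀ p B k`. What remains is the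
deterministic asymptotics of this sum.

A small bin near `t` has length about `2^(-B) / G'(t)`. Its optimal distortion is about `φ₀(t)`
times the (`p+1`)-st power of this length, divided by `(p+1) 2^p`. After multiplication by
`G'(t)^(p-2)` all powers of `G'` cancel, and each bin contributes about `A 2^(-B(p+1)) / ((p+1)
2^p)`, independently of `t` (`tendsto_cellDistortion_binIndex`).

This limit is only pointwise in `t`, and two bins are always unbounded. Every bin has `ν`-mass
`2^(-B)`, so the rescaled sum is an integral against `ν` and dominated convergence applies, given
the uniform bound `cellDistortion_le`. That bound comes from log-concavity of `G'` and from
comparing the optimal level with the bin endpoint nearest to `0`. -/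

/-! ### The point density as a Gaussian density -/

lemma setIntegral_gaussianReal {v : ℝ≥0} (hv : v ≠ 0) {s : Set ℝ}
    (hs : MeasurableSet s) (f : ℝ → ℝ) :
    ∫ t in s, f t ∂gaussianReal 0 v = ∫ t in s, f t * gaussianPDFReal 0 v t := by
  rw [← integral_indicator hs, integral_gaussianReal_eq_integral_smul hv, ← integral_indicator hs]
  refine integral_congr_ae (.of_forall fun t => ?_)
  by_cases h : t ∈ s <;> simp [h, mul_comm]

/-- The constant `2πσ₀²·3^(3/2)`, the ratio of `φ₀` to the cube of `G'`. -/
noncomputable def cubeRatio (σ₀ : ℝ≥0) : ℝ := 2 * Real.pi * (σ₀ : ℝ) ^ 2 * (3 : ℝ) ^ (3 / 2 : ℝ)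

variable {σ₀ : ℝ≥0}

lemma cubeRatio_pos (hσ₀ : 0 < σ₀) : 0 < cubeRatio σ₀ := by
  have : (0 : ℝ) < σ₀ := hσ₀
  unfold cubeRatio; positivity

lemma three_mul_sq_ne_zero (hσ₀ : 0 < σ₀) : 3 * σ₀ ^ 2 ≠ 0 := by positivity

/-- Cubing divides the variance `3σ₀²` by three in the exponent; the normalizing factors leave `(2π
· 3σ₀²)^(3/2) / (2πσ₀²)^(1/2)`. -/
lemma pdf_eq_cubeRatio_mul (hσ₀ : 0 < σ₀) (x : ℝ) :
    pdf σ₀ x = cubeRatio σ₀ * gaussianPDFReal 0 (3 * σ₀ ^ 2) x ^ 3 := by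
  have h0 : (0 : ℝ) < σ₀ := hσ₀
  have h3 : (3 : ℝ) ^ (3 / 2 : ℝ) = √3 ^ 3 := by
    rw [Real.sqrt_eq_rpow, ← Real.rpow_natCast, ← Real.rpow_mul (by norm_num)]
    norm_num
  have hs : √(2 * Real.pi * (3 * (σ₀ : ℝ) ^ 2)) = √3 * √(2 * Real.pi * σ₀ ^ 2) := by
    rw [← Real.sqrt_mul (by norm_num)]; ring_nf
  have hq : √(2 * Real.pi * (σ₀ : ℝ) ^ 2) ^ 2 = 2 * Real.pi * σ₀ ^ 2 :=
    Real.sq_sqrt (by positivity)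
  have hpos : 0 < √(2 * Real.pi * (σ₀ : ℝ) ^ 2) := by positivity
  have he : Real.exp (-(x - 0) ^ 2 / (2 * (3 * (σ₀ : ℝ) ^ 2))) ^ 3
      = Real.exp (-(x - 0) ^ 2 / (2 * (σ₀ : ℝ) ^ 2)) := by
    rw [← Real.exp_nat_mul]; congr 1; push_cast; field_simp
  unfold pdf cubeRatio gaussianPDFReal
  push_cast
  rw [mul_pow, he, h3, hs]
  generalize √(2 * Real.pi * (σ₀ : ℝ) ^ 2) = r at hq hpos
  rw [← hq]
  field_simp

lemma pdf_rpow_third (hσ₀ : 0 < σ₀) (x : ℝ) :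
    pdf σ₀ x ^ (1 / 3 : ℝ)
      = cubeRatio σ₀ ^ (1 / 3 : ℝ) * gaussianPDFReal 0 (3 * σ₀ ^ 2) x := by
  rw [pdf_eq_cubeRatio_mul hσ₀, Real.mul_rpow (cubeRatio_pos hσ₀).le
    (pow_nonneg (gaussianPDFReal_nonneg _ _ _) _), ← Real.rpow_natCast,
    ← Real.rpow_mul (gaussianPDFReal_nonneg _ _ _)]
  norm_num

lemma integral_pdf_rpow_third (hσ₀ : 0 < σ₀) :
    ∫ t, pdf σ₀ t ^ (1 / 3 : ℝ) = cubeRatio σ₀ ^ (1 / 3 : ℝ) := by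
  simp_rw [pdf_rpow_third hσ₀]
  rw [integral_const_mul, integral_gaussianPDFReal_eq_one 0 (three_mul_sq_ne_zero hσ₀), mul_one]

lemma qpdf_eq (hσ₀ : 0 < σ₀) : qpdf σ₀ = gaussianPDFReal 0 (3 * σ₀ ^ 2) := by
  ext x
  have := Real.rpow_pos_of_pos (cubeRatio_pos hσ₀) (1 / 3)
  rw [qpdf, integral_pdf_rpow_third hσ₀, pdf_rpow_third hσ₀, inv_mul_cancel_left₀ this.ne']

lemma fnorm_pdf (hσ₀ : 0 < σ₀) : fnorm (1 / 3) (pdf σ₀) = cubeRatio σ₀ := by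
  have h : ∀ t, |pdf σ₀ t| = pdf σ₀ t := fun t => abs_of_nonneg (gaussianPDFReal_nonneg _ _ _)
  simp_rw [fnorm, h]
  rw [integral_pdf_rpow_third hσ₀, ← Real.rpow_mul (cubeRatio_pos hσ₀).le]
  norm_num

lemma pdf_eq (hσ₀ : 0 < σ₀) (x : ℝ) : pdf σ₀ x = cubeRatio σ₀ * qpdf σ₀ x ^ 3 := by
  rw [qpdf_eq hσ₀, pdf_eq_cubeRatio_mul hσ₀]

lemma qpdf_apply (hσ₀ : 0 < σ₀) (x : ℝ) :
    qpdf σ₀ x = qpdf σ₀ 0 * Real.exp (-(x ^ 2) / (6 * (σ₀ : ℝ) ^ 2)) := by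
  rw [qpdf_eq hσ₀]
  simp only [gaussianPDFReal, sub_zero]
  push_cast
  norm_num
  left; ring_nf

lemma qpdf_pos (hσ₀ : 0 < σ₀) (x : ℝ) : 0 < qpdf σ₀ x := by
  rw [qpdf_eq hσ₀]; exact gaussianPDFReal_pos _ _ _ (three_mul_sq_ne_zero hσ₀)

lemma qpdf_neg (hσ₀ : 0 < σ₀) (x : ℝ) : qpdf σ₀ (-x) = qpdf σ₀ x := by
  rw [qpdf_apply hσ₀, qpdf_apply hσ₀ x, neg_sq]

lemma qpdf_le_qpdf (hσ₀ : 0 < σ₀) {x y : ℝ} (h : |x| ≤ |y|) : qpdf σ₀ y ≤ qpdf σ₀ x := by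
  rw [qpdf_apply hσ₀, qpdf_apply hσ₀ x]
  have := sq_le_sq.2 h
  have := (qpdf_pos hσ₀ 0).le
  gcongr

lemma continuous_qpdf (hσ₀ : 0 < σ₀) : Continuous (qpdf σ₀) := by
  have : qpdf σ₀ = fun x => qpdf σ₀ 0 * Real.exp (-(x ^ 2) / (6 * (σ₀ : ℝ) ^ 2)) :=
    funext (qpdf_apply hσ₀)
  rw [this]; fun_prop

lemma integrable_qpdf (hσ₀ : 0 < σ₀) : Integrable (qpdf σ₀) := by
  rw [qpdf_eq hσ₀]; exact integrable_gaussianPDFReal _ _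

lemma integral_qpdf (hσ₀ : 0 < σ₀) : ∫ t, qpdf σ₀ t = 1 := by
  rw [qpdf_eq hσ₀]; exact integral_gaussianPDFReal_eq_one _ (three_mul_sq_ne_zero hσ₀)

/-- Weighted log-concavity of the density `G'`. -/
lemma qpdf_pow_mul_sq_le (hσ₀ : 0 < σ₀) (n : ℕ) (x t : ℝ) :
    qpdf σ₀ x ^ n * qpdf σ₀ t ^ 2 ≤ qpdf σ₀ (x + 2 / (n + 2) * (t - x)) ^ (n + 2) := by
  have h0 : (0 : ℝ) < σ₀ := hσ₀
  rw [qpdf_apply hσ₀ x, qpdf_apply hσ₀ t, qpdf_apply hσ₀ (x + _), mul_pow, mul_pow, mul_pow,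
    pow_add]
  have := pow_nonneg (qpdf_pos hσ₀ 0).le n
  have := pow_nonneg (qpdf_pos hσ₀ 0).le 2
  rw [mul_mul_mul_comm]
  refine mul_le_mul_of_nonneg_left ?_ (by positivity)
  rw [← Real.exp_nat_mul, ← Real.exp_nat_mul, ← Real.exp_nat_mul, ← Real.exp_add,
    Real.exp_le_exp]
  -- The intermediate point is the weighted mean `(n x + 2 t) / (n + 2)`, so this is convexity of
  -- the square, with its exact defect.
  have key : (n + 2 : ℝ) * (x + 2 / (n + 2) * (t - x)) ^ 2 ≤ n * x ^ 2 + 2 * t ^ 2 := by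
    have hn : (0 : ℝ) < n + 2 := by positivity
    have : n * x ^ 2 + 2 * t ^ 2 - (n + 2 : ℝ) * (x + 2 / (n + 2) * (t - x)) ^ 2
        = 2 * n / (n + 2) * (t - x) ^ 2 := by
      field_simp; ring
    have h2 : 0 ≤ 2 * n / (n + 2) * (t - x) ^ 2 := by positivity
    linarith
  push_cast
  rw [← sub_nonneg]
  have : (n + 2 : ℝ) * (-(x + 2 / (n + 2) * (t - x)) ^ 2 / (6 * (σ₀ : ℝ) ^ 2))
      - (n * (-x ^ 2 / (6 * (σ₀ : ℝ) ^ 2)) + 2 * (-t ^ 2 / (6 * (σ₀ : ℝ) ^ 2)))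
      = (n * x ^ 2 + 2 * t ^ 2 - (n + 2 : ℝ) * (x + 2 / (n + 2) * (t - x)) ^ 2)
        / (6 * (σ₀ : ℝ) ^ 2) := by ring
  rw [this]
  exact div_nonneg (by linarith) (by positivity)

/-! ### The compressor as a distribution function -/

lemma hasDerivAt_compressor (hσ₀ : 0 < σ₀) (x : ℝ) :
    HasDerivAt (compressor σ₀) (qpdf σ₀ x) x := by
  have hc := continuous_qpdf hσ₀
  have hi := integrable_qpdf hσ₀
  have h : compressor σ₀ = fun y => compressor σ₀ 0 + ∫ t in (0 : ℝ)..y, qpdf σ₀ t := by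
    ext y
    rw [compressor, compressor, ← intervalIntegral.integral_Iic_sub_Iic hi.integrableOn
      hi.integrableOn]
    ring
  rw [h]
  exact (intervalIntegral.integral_hasDerivAt_right (hc.intervalIntegrable _ _)
    (hc.stronglyMeasurableAtFilter _ _) hc.continuousAt).const_add _

lemma continuous_compressor (hσ₀ : 0 < σ₀) : Continuous (compressor σ₀) :=
  continuous_iff_continuousAt.2 fun x => (hasDerivAt_compressor hσ₀ x).continuousAt

lemma strictMono_compressor (hσ₀ : 0 < σ₀) : StrictMono (compressor σ₀) :=
  strictMono_of_hasDerivAt_pos (hasDerivAt_compressor hσ₀) (qpdf_pos hσ₀)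

lemma compressor_eq_real (hσ₀ : 0 < σ₀) (x : ℝ) :
    compressor σ₀ x = (gaussianReal 0 (3 * σ₀ ^ 2)).real (Set.Iic x) := by
  have := setIntegral_gaussianReal (three_mul_sq_ne_zero hσ₀)
    (measurableSet_Iic (a := x)) (fun _ => (1 : ℝ))
  rw [compressor, qpdf_eq hσ₀]
  simpa using this.symm

lemma compressor_neg (hσ₀ : 0 < σ₀) (x : ℝ) : compressor σ₀ (-x) = 1 - compressor σ₀ x := by
  have hi := integrable_qpdf hσ₀
  have h1 := integral_comp_neg_Iic (-x) (qpdf σ₀)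
  simp_rw [qpdf_neg hσ₀, neg_neg] at h1
  have h2 := intervalIntegral.integral_Iic_add_Ioi (b := x) hi.integrableOn hi.integrableOn
  rw [integral_qpdf hσ₀] at h2
  rw [compressor, compressor, h1, ← h2]
  ring

lemma compressor_zero (hσ₀ : 0 < σ₀) : compressor σ₀ 0 = 1 / 2 := by
  have := compressor_neg hσ₀ 0
  rw [neg_zero] at this
  linarith

lemma tendsto_compressor_atTop (hσ₀ : 0 < σ₀) : Tendsto (compressor σ₀) atTop (𝓝 1) := by
  refine (tendsto_cdf_atTop (gaussianReal 0 (3 * σ₀ ^ 2))).congr fun x => ?_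
  rw [compressor_eq_real hσ₀, cdf_eq_real]

lemma tendsto_compressor_atBot (hσ₀ : 0 < σ₀) : Tendsto (compressor σ₀) atBot (𝓝 0) := by
  refine (tendsto_cdf_atBot (gaussianReal 0 (3 * σ₀ ^ 2))).congr fun x => ?_
  rw [compressor_eq_real hσ₀, cdf_eq_real]

lemma compressor_pos (hσ₀ : 0 < σ₀) (x : ℝ) : 0 < compressor σ₀ x :=
  ((strictMono_compressor hσ₀).monotone.le_of_tendsto (tendsto_compressor_atBot hσ₀)
    (x - 1)).trans_lt (strictMono_compressor hσ₀ (by linarith))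

lemma compressor_lt_one (hσ₀ : 0 < σ₀) (x : ℝ) : compressor σ₀ x < 1 := by
  have := compressor_pos hσ₀ (-x)
  rw [compressor_neg hσ₀] at this
  linarith

lemma exists_compressor_eq (hσ₀ : 0 < σ₀) {u : ℝ} (h0 : 0 < u) (h1 : u < 1) :
    ∃ x, compressor σ₀ x = u :=
  mem_range_of_exists_le_of_exists_ge (continuous_compressor hσ₀)
    (((tendsto_compressor_atBot hσ₀).eventually (Iic_mem_nhds h0)).exists)
    (((tendsto_compressor_atTop hσ₀).eventually (Ici_mem_nhds h1)).exists)

/-- Sublevel sets of `G` replace half-lines, so that `u = 0` and `u = 1` cover the infinite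
thresholds. -/
lemma setIntegral_qpdf_compressor_lt (hσ₀ : 0 < σ₀) {u : ℝ} (h0 : 0 ≤ u) (h1 : u ≤ 1) :
    ∫ t in {t | compressor σ₀ t < u}, qpdf σ₀ t = u := by
  rcases h0.eq_or_lt with rfl | h0
  · have : {t | compressor σ₀ t < 0} = ∅ := by
      ext t; simpa using (compressor_pos hσ₀ t).le
    simp [this]
  rcases h1.eq_or_lt with rfl | h1
  · have : {t | compressor σ₀ t < 1} = Set.univ := by
      ext t; simpa using compressor_lt_one hσ₀ t
    simp [this, integral_qpdf hσ₀]
  obtain ⟨a, rfl⟩ := exists_compressor_eq hσ₀ h0 h1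
  have : {t | compressor σ₀ t < compressor σ₀ a} = Set.Iio a := by
    ext t; simp [(strictMono_compressor hσ₀).lt_iff_lt]
  rw [this, ← integral_Iic_eq_integral_Iio]
  rfl

/-- The mean value theorem for the compressor. -/
lemma exists_compressor_sub_eq (hσ₀ : 0 < σ₀) {a b : ℝ} (h : a < b) :
    ∃ c ∈ Set.Ioo a b, compressor σ₀ b - compressor σ₀ a = qpdf σ₀ c * (b - a) := by
  obtain ⟨c, hc, h'⟩ := exists_hasDerivAt_eq_slope (compressor σ₀) (qpdf σ₀) h
    (continuous_compressor hσ₀).continuousOn fun x _ => hasDerivAt_compressor hσ₀ x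
  refine ⟨c, hc, ?_⟩
  rw [h', div_mul_cancel₀ _ (by linarith)]

/-! ### The tail estimate -/

/-- Log-concavity bounds the product of densities by `G'(s)^(n+2)` at the weighted mean `s` of `x`
and `t`. As `G'` decreases on `[0, ∞)`, `G'(s) (s - x) ≤ G(s) - G(x) ≤ G(t) - G(x)`. The constant is
the ratio `(t - x) / (s - x) = (n + 2) / 2`. The bound stays useful when `t` is unbounded. -/
lemma qpdf_pow_mul_abs_pow_le_of_nonneg (hσ₀ : 0 < σ₀) (n : ℕ) {x t : ℝ} (hx : 0 ≤ x)
    (hxt : x ≤ t) :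
    qpdf σ₀ x ^ n * qpdf σ₀ t ^ 2 * |t - x| ^ (n + 2)
      ≤ ((n + 2) / 2) ^ (n + 2) * |compressor σ₀ t - compressor σ₀ x| ^ (n + 2) := by
  have hn : (0 : ℝ) < n + 2 := by positivity
  rcases hxt.eq_or_lt with rfl | hxt
  · simp
  set s := x + 2 / (n + 2) * (t - x) with hs
  have hxs : x < s := by
    have : 0 < 2 / (n + 2 : ℝ) * (t - x) := mul_pos (by positivity) (by linarith)
    linarith
  have hst : s ≤ t := by
    have : 2 / (n + 2 : ℝ) * (t - x) ≤ 1 * (t - x) := by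
      refine mul_le_mul_of_nonneg_right ?_ (by linarith)
      rw [div_le_one hn]
      have : (0 : ℝ) ≤ n := by positivity
      linarith
    linarith
  obtain ⟨c, hc, h⟩ := exists_compressor_sub_eq hσ₀ hxs
  have h1 : qpdf σ₀ s * (s - x) ≤ compressor σ₀ t - compressor σ₀ x := by
    have h2 : qpdf σ₀ s ≤ qpdf σ₀ c := qpdf_le_qpdf hσ₀ (by
      rw [abs_of_nonneg (by linarith [hc.1]), abs_of_nonneg (by linarith)]; exact hc.2.le)
    have h3 := (strictMono_compressor hσ₀).monotone hst
    have h4 := mul_le_mul_of_nonneg_right h2 (sub_nonneg.2 hxs.le)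
    linarith
  have htx : t - x = (n + 2) / 2 * (s - x) := by rw [hs]; field_simp; ring
  rw [abs_of_pos (by linarith : 0 < t - x),
    abs_of_nonneg (sub_nonneg.2 ((strictMono_compressor hσ₀).monotone hxt.le))]
  have hsx : 0 ≤ s - x := by linarith
  have hq := (qpdf_pos hσ₀ s).le
  calc qpdf σ₀ x ^ n * qpdf σ₀ t ^ 2 * (t - x) ^ (n + 2)
      ≤ qpdf σ₀ s ^ (n + 2) * (t - x) ^ (n + 2) :=
        mul_le_mul_of_nonneg_right (qpdf_pow_mul_sq_le hσ₀ n x t)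
          (pow_nonneg (by linarith) _)
    _ = ((n + 2) / 2) ^ (n + 2) * (qpdf σ₀ s * (s - x)) ^ (n + 2) := by
        rw [htx, ← mul_pow, ← mul_pow]; congr 1; ring
    _ ≤ _ := by gcongr

lemma qpdf_pow_mul_abs_pow_le_of_nonpos (hσ₀ : 0 < σ₀) (n : ℕ) {x t : ℝ} (hx : x ≤ 0)
    (hxt : t ≤ x) :
    qpdf σ₀ x ^ n * qpdf σ₀ t ^ 2 * |t - x| ^ (n + 2)
      ≤ ((n + 2) / 2) ^ (n + 2) * |compressor σ₀ t - compressor σ₀ x| ^ (n + 2) := by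
  have := qpdf_pow_mul_abs_pow_le_of_nonneg hσ₀ n (neg_nonneg.2 hx) (neg_le_neg hxt)
  rw [qpdf_neg hσ₀, qpdf_neg hσ₀, compressor_neg hσ₀, compressor_neg hσ₀] at this
  rwa [← abs_neg (t - x), ← abs_neg (compressor σ₀ t - _),
    show -(t - x) = -t - -x by ring,
    show -(compressor σ₀ t - compressor σ₀ x)
      = 1 - compressor σ₀ t - (1 - compressor σ₀ x) by ring]

/-! ### Minimizers of absolute moments -/

section AbsMoment

variable {μ : Measure ℝ} [IsFiniteMeasure μ]

lemma integrable_abs_add_pow (hm : ∀ n : ℕ, Integrable (fun t : ℝ => |t| ^ n) μ) {c : ℝ}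
    (hc : 0 ≤ c) (n : ℕ) : Integrable (fun t => (|t| + c) ^ n) μ := by
  refine Integrable.mono' (((hm n).add (integrable_const (c ^ n))).const_mul (2 ^ (n - 1)))
    (by fun_prop) (.of_forall fun t => ?_)
  have : 0 ≤ |t| + c := add_nonneg (abs_nonneg _) hc
  rw [Real.norm_of_nonneg (pow_nonneg this _)]
  exact add_pow_le (abs_nonneg _) hc n

lemma integrable_abs_sub_pow (hm : ∀ n : ℕ, Integrable (fun t : ℝ => |t| ^ n) μ) (x : ℝ)
    (n : ℕ) : Integrable (fun t => |t - x| ^ n) μ := by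
  refine (integrable_abs_add_pow hm (abs_nonneg x) n).mono' (by fun_prop)
    (.of_forall fun t => ?_)
  rw [Real.norm_of_nonneg (by positivity)]
  exact pow_le_pow_left₀ (abs_nonneg _) (abs_sub _ _) n

lemma hasDerivAt_abs_sub_pow (n : ℕ) (t x : ℝ) :
    HasDerivAt (fun x => |t - x| ^ (n + 2)) ((n + 2) * |t - x| ^ n * (x - t)) x := by
  have h := (hasDerivAt_abs_rpow (x - t) (p := (n + 2 : ℕ))
    (by push_cast; linarith [n.cast_nonneg (α := ℝ)])).comp x ((hasDerivAt_id x).sub_const t)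
  have e : ((n + 2 : ℕ) : ℝ) - 2 = (n : ℕ) := by push_cast; ring
  rw [e, Real.rpow_natCast] at h
  have e' : (fun x => |t - x| ^ (n + 2))
      = (fun x => |x| ^ ((n + 2 : ℕ) : ℝ)) ∘ fun x => id x - t := by
    ext y
    simp only [Function.comp, id, Real.rpow_natCast, abs_sub_comm]
  rw [e']
  exact h.congr_deriv (by push_cast; rw [abs_sub_comm]; ring)

lemma hasDerivAt_integral_abs_sub_pow (hm : ∀ n : ℕ, Integrable (fun t : ℝ => |t| ^ n) μ) (n : ℕ)
    (x : ℝ) :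
    Integrable (fun t => (n + 2) * |t - x| ^ n * (x - t)) μ ∧
    HasDerivAt (fun x => ∫ t, |t - x| ^ (n + 2) ∂μ) (∫ t, (n + 2) * |t - x| ^ n * (x - t) ∂μ) x := by
  refine hasDerivAt_integral_of_dominated_loc_of_deriv_le (Metric.ball_mem_nhds x one_pos)
    (bound := fun t => (n + 2) * (|t| + (|x| + 1)) ^ (n + 1))
    (F' := fun x t => (n + 2) * |t - x| ^ n * (x - t))
    (.of_forall fun y => by fun_prop) (integrable_abs_sub_pow hm x _) (by fun_prop)
    (.of_forall fun t y hy => ?_)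
    ((integrable_abs_add_pow hm (by positivity) _).const_mul _)
    (.of_forall fun t y _ => hasDerivAt_abs_sub_pow n t y)
  have hb : |t - y| ≤ |t| + (|x| + 1) := by
    have h1 := abs_sub t y
    have h2 : |y - x| < 1 := by simpa [Real.dist_eq] using hy
    have h3 := abs_add_le (y - x) x
    rw [sub_add_cancel] at h3
    linarith
  rw [norm_mul, norm_mul, norm_pow, Real.norm_eq_abs, Real.norm_eq_abs, Real.norm_eq_abs, abs_abs,
    abs_sub_comm y t, mul_assoc, ← pow_succ, abs_of_pos (by positivity : (0 : ℝ) < n + 2)]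
  gcongr

/-- The moment is continuous in `x` and coercive: integrating `|x|^(n+2) ≤ 2^(n+1) (|t - x|^(n+2) +
|t|^(n+2))` bounds it below by a positive multiple of `|x|^(n+2)` minus a constant. -/
lemma exists_forall_integral_abs_sub_pow_le (hm : ∀ n : ℕ, Integrable (fun t : ℝ => |t| ^ n) μ)
    (hμ : μ ≠ 0) (n : ℕ) :
    ∃ x, ∀ y, ∫ t, |t - x| ^ (n + 2) ∂μ ≤ ∫ t, |t - y| ^ (n + 2) ∂μ := by
  refine Continuous.exists_forall_le (continuous_iff_continuousAt.2 fun x =>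
    (hasDerivAt_integral_abs_sub_pow hm n x).2.continuousAt) ?_
  have hpos : 0 < μ.real Set.univ := by
    rw [measureReal_def]
    exact ENNReal.toReal_pos (by simpa using hμ) (measure_ne_top _ _)
  have key : ∀ x : ℝ, |x| ^ (n + 2) * (μ.real Set.univ / 2 ^ (n + 1)) - ∫ t, |t| ^ (n + 2) ∂μ
      ≤ ∫ t, |t - x| ^ (n + 2) ∂μ := by
    intro x
    have h1 : ∫ _, |x| ^ (n + 2) ∂μ
        ≤ ∫ t, 2 ^ (n + 1) * (|t - x| ^ (n + 2) + |t| ^ (n + 2)) ∂μ := by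
      refine integral_mono (integrable_const _)
        (((integrable_abs_sub_pow hm x _).add (hm _)).const_mul _) fun t => ?_
      refine le_trans (pow_le_pow_left₀ (abs_nonneg x) ?_ _)
        (add_pow_le (abs_nonneg (t - x)) (abs_nonneg t) (n + 2))
      have := abs_sub t (t - x)
      rw [sub_sub_cancel] at this
      linarith
    rw [integral_const, integral_const_mul, integral_add (integrable_abs_sub_pow hm x _) (hm _),
      smul_eq_mul] at h1
    have h2 : (0 : ℝ) < 2 ^ (n + 1) := by positivity
    rw [sub_le_iff_le_add, ← mul_div_assoc, div_le_iff₀ h2]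
    linarith
  refine tendsto_atTop_mono key (tendsto_atTop_add_const_right _ _ ?_)
  refine Tendsto.atTop_mul_const (by positivity) ?_
  exact (tendsto_pow_atTop (by omega)).comp tendsto_norm_cocompact_atTop

/-- The derivative vanishes at a minimizer, but its integrand would have a strict sign almost
everywhere if all the mass lay on one side. This is what places the optimal level inside its bin. -/
lemma not_ae_lt_of_forall_integral_le (hm : ∀ n : ℕ, Integrable (fun t : ℝ => |t| ^ n) μ)
    (hμ : μ ≠ 0) (n : ℕ) {x : ℝ}
    (hx : ∀ y, ∫ t, |t - x| ^ (n + 2) ∂μ ≤ ∫ t, |t - y| ^ (n + 2) ∂μ) :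
    (¬ ∀ᵐ t ∂μ, t < x) ∧ ¬ ∀ᵐ t ∂μ, x < t := by
  have hd := hasDerivAt_integral_abs_sub_pow hm n x
  have h0 := IsLocalMin.hasDerivAt_eq_zero (.of_forall hx) hd.2
  have : NeZero μ := ⟨hμ⟩
  constructor
  · intro h
    rw [integral_eq_zero_iff_of_nonneg_ae ?_ hd.1] at h0
    · obtain ⟨t, ht, ht'⟩ := (h.and h0).exists
      have h1 : 0 < |t - x| := abs_pos.2 (by linarith)
      have h2 : 0 < x - t := by linarith
      have : 0 < (n + 2) * |t - x| ^ n * (x - t) := by positivity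
      exact this.ne' ht'
    · filter_upwards [h] with t ht
      have h2 : 0 < x - t := by linarith
      simp only [Pi.zero_apply]
      positivity
  · intro h
    have hi : Integrable (fun t => -((n + 2) * |t - x| ^ n * (x - t))) μ := hd.1.neg
    rw [← neg_eq_zero, ← integral_neg, integral_eq_zero_iff_of_nonneg_ae ?_ hi] at h0
    · obtain ⟨t, ht, ht'⟩ := (h.and h0).exists
      have h1 : 0 < |t - x| := abs_pos.2 (by linarith)
      have h2 : 0 < t - x := by linarith
      have : 0 < (n + 2) * |t - x| ^ n * (t - x) := by positivity
      refine this.ne' (Eq.trans ?_ ht')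
      ring
    · filter_upwards [h] with t ht
      have h2 : 0 < t - x := by linarith
      have : 0 ≤ (n + 2) * |t - x| ^ n * (t - x) := by positivity
      simp only [Pi.zero_apply]
      linarith

end AbsMoment

/-! ### Bins and their optimal levels -/

lemma integrable_abs_pow_gaussianReal (v : ℝ≥0) (n : ℕ) :
    Integrable (fun t : ℝ => |t| ^ n) (gaussianReal 0 v) := by
  rcases eq_or_ne n 0 with rfl | hn
  · simp
  · exact (memLp_id_gaussianReal (μ := 0) (v := v) n).integrable_norm_pow hn

lemma measurableSet_bin (hσ₀ : 0 < σ₀) (B k : ℕ) : MeasurableSet (bin σ₀ B k) :=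
  (measurableSet_le measurable_const (continuous_compressor hσ₀).measurable).inter
    (measurableSet_lt (continuous_compressor hσ₀).measurable measurable_const)

lemma binDistortion_eq (hσ₀ : 0 < σ₀) (p B k : ℕ) (x : ℝ) :
    binDistortion σ₀ p B k x
      = ∫ t, |t - x| ^ p ∂((gaussianReal 0 (σ₀ ^ 2)).restrict (bin σ₀ B k)) :=
  (setIntegral_gaussianReal (by positivity) (measurableSet_bin hσ₀ B k) _).symm

lemma setIntegral_qpdf_bin (hσ₀ : 0 < σ₀) {B k : ℕ} (hk : k < 2 ^ B) :
    ∫ t in bin σ₀ B k, qpdf σ₀ t = 1 / 2 ^ B := by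
  have hB : (0 : ℝ) < 2 ^ B := by positivity
  have hk' : (k : ℝ) + 1 ≤ 2 ^ B := by exact_mod_cast hk
  have he : bin σ₀ B k = {t | compressor σ₀ t < (k + 1) / 2 ^ B}
      \ {t | compressor σ₀ t < k / 2 ^ B} := by
    ext t; simp [bin, and_comm]
  rw [he, setIntegral_sdiff (measurableSet_lt (continuous_compressor hσ₀).measurable measurable_const)
    (integrable_qpdf hσ₀).integrableOn, setIntegral_qpdf_compressor_lt hσ₀ (by positivity),
    setIntegral_qpdf_compressor_lt hσ₀ (by positivity)]
  · ring
  · rw [div_le_one hB]; linarith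
  · rw [div_le_one hB]; linarith
  · intro t ht
    exact lt_of_lt_of_le (b := (k : ℝ) / 2 ^ B) ht (by gcongr; linarith)

lemma restrict_bin_ne_zero (hσ₀ : 0 < σ₀) {B k : ℕ} (hk : k < 2 ^ B) :
    (gaussianReal 0 (σ₀ ^ 2)).restrict (bin σ₀ B k) ≠ 0 := by
  intro h
  rw [Measure.restrict_eq_zero] at h
  have h1 := gaussianReal_absolutelyContinuous' 0 (v := σ₀ ^ 2) (by positivity) h
  have h2 := setIntegral_qpdf_bin hσ₀ hk
  rw [setIntegral_measure_zero _ h1] at h2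
  have : (0 : ℝ) < 1 / 2 ^ B := by positivity
  linarith

lemma exists_mem_bin_forall_binDistortion_le (hσ₀ : 0 < σ₀) {p B k : ℕ} (hp : 2 ≤ p)
    (hk : k < 2 ^ B) :
    ∃ x ∈ bin σ₀ B k, ∀ y, binDistortion σ₀ p B k x ≤ binDistortion σ₀ p B k y := by
  obtain ⟨n, rfl⟩ := Nat.exists_eq_add_of_le' hp
  simp_rw [binDistortion_eq hσ₀]
  have hm : ∀ n : ℕ, Integrable (fun t : ℝ => |t| ^ n)
      ((gaussianReal 0 (σ₀ ^ 2)).restrict (bin σ₀ B k)) :=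
    fun n => (integrable_abs_pow_gaussianReal _ n).restrict
  have h0 := restrict_bin_ne_zero hσ₀ hk
  obtain ⟨x, hx⟩ := exists_forall_integral_abs_sub_pow_le hm h0 n
  obtain ⟨h1, h2⟩ := not_ae_lt_of_forall_integral_le hm h0 n hx
  refine ⟨x, ?_, hx⟩
  have hmem := ae_restrict_mem (μ := gaussianReal 0 (σ₀ ^ 2)) (measurableSet_bin hσ₀ B k)
  have hlt := fun {a b} => (strictMono_compressor hσ₀).lt_iff_lt (a := a) (b := b)
  constructor
  · by_contra! h
    refine h2 ?_
    filter_upwards [hmem] with t ht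
    exact hlt.1 (h.trans_le ht.1)
  · by_contra! h
    refine h1 ?_
    filter_upwards [hmem] with t ht
    exact hlt.1 (ht.2.trans_le h)

/-- Some global minimizer lies in the bin, so a minimizer over the bin is global. Comparison points
outside the bin, such as its right endpoint, are thus allowed. -/
lemma level_mem_bin_and_binDistortion_le (hσ₀ : 0 < σ₀) {p B k : ℕ} (hp : 2 ≤ p)
    (hk : k < 2 ^ B) :
    level σ₀ p B k ∈ bin σ₀ B k ∧
      ∀ y, binDistortion σ₀ p B k (level σ₀ p B k) ≤ binDistortion σ₀ p B k y := by
  obtain ⟨x, hx, hmin⟩ := exists_mem_bin_forall_binDistortion_le hσ₀ hp hk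
  have h := Classical.epsilon_spec (p := fun x : ℝ =>
    x ∈ bin σ₀ B k ∧ IsMinOn (binDistortion σ₀ p B k) (bin σ₀ B k) x)
    ⟨x, hx, fun y _ => hmin y⟩
  exact ⟨h.1, fun y => (h.2 hx).trans (hmin y)⟩

/-! ### Uniform bound on the contribution of a bin -/

/-- The weighted distortion contributed by the `k`-th bin. -/
noncomputable def cellDistortion (σ₀ : ℝ≥0) (p B k : ℕ) : ℝ :=
  qpdf σ₀ (level σ₀ p B k) ^ (p - 2) * binDistortion σ₀ p B k (level σ₀ p B k)

lemma pdf_nonneg (σ₀ : ℝ≥0) (x : ℝ) : 0 ≤ pdf σ₀ x := gaussianPDFReal_nonneg _ _ _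

lemma binDistortion_nonneg (σ₀ : ℝ≥0) (p B k : ℕ) (x : ℝ) : 0 ≤ binDistortion σ₀ p B k x :=
  integral_nonneg fun t => mul_nonneg (by positivity) (pdf_nonneg σ₀ t)

lemma cellDistortion_nonneg (hσ₀ : 0 < σ₀) (p B k : ℕ) : 0 ≤ cellDistortion σ₀ p B k :=
  mul_nonneg (pow_nonneg (qpdf_pos hσ₀ _).le _) (binDistortion_nonneg _ _ _ _ _)

/-- Here `x` stands for the endpoint of the bin nearest to `0`. Passing from the level to `x`
increases both factors: the weight because `G'` decreases in `|·|`, the distortion by minimality. -/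
lemma cellDistortion_le_of_forall_mem_bin (hσ₀ : 0 < σ₀) {n B k : ℕ} (hk : k < 2 ^ B) {x : ℝ}
    (habs : ∀ t ∈ bin σ₀ B k, |x| ≤ |t|)
    (hG : ∀ t ∈ bin σ₀ B k, |compressor σ₀ t - compressor σ₀ x| ≤ 1 / 2 ^ B)
    (hq : ∀ t ∈ bin σ₀ B k, qpdf σ₀ x ^ n * qpdf σ₀ t ^ 2 * |t - x| ^ (n + 2)
      ≤ ((n + 2) / 2) ^ (n + 2) * |compressor σ₀ t - compressor σ₀ x| ^ (n + 2)) :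
    cellDistortion σ₀ (n + 2) B k
      ≤ cubeRatio σ₀ * ((n + 2) / 2) ^ (n + 2) * (1 / 2 ^ B) ^ (n + 3) := by
  obtain ⟨hmem, hmin⟩ := level_mem_bin_and_binDistortion_le hσ₀ (p := n + 2) (by omega) hk
  have hA := (cubeRatio_pos hσ₀).le
  have h1 : cellDistortion σ₀ (n + 2) B k
      ≤ qpdf σ₀ x ^ n * binDistortion σ₀ (n + 2) B k x :=
    mul_le_mul (pow_le_pow_left₀ (qpdf_pos hσ₀ _).le (qpdf_le_qpdf hσ₀ (habs _ hmem)) _) (hmin x)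
      (binDistortion_nonneg _ _ _ _ _) (pow_nonneg (qpdf_pos hσ₀ _).le _)
  refine h1.trans ?_
  -- Of the three factors of `G'(t)` in `φ₀(t)`, two enter the pointwise bound `hq`; the third is
  -- integrated over the bin and gives one more `2^(-B)`.
  have h2 : ∫ t in bin σ₀ B k, qpdf σ₀ x ^ n * (|t - x| ^ (n + 2) * pdf σ₀ t)
      ≤ ∫ t in bin σ₀ B k,
        cubeRatio σ₀ * ((n + 2) / 2) ^ (n + 2) * (1 / 2 ^ B) ^ (n + 2) * qpdf σ₀ t := by
    refine integral_mono_of_nonneg (.of_forall fun t => ?_)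
      ((integrable_qpdf hσ₀).integrableOn.const_mul _) ?_
    · exact mul_nonneg (pow_nonneg (qpdf_pos hσ₀ _).le _)
        (mul_nonneg (by positivity) (pdf_nonneg σ₀ t))
    · filter_upwards [ae_restrict_mem (measurableSet_bin hσ₀ B k)] with t ht
      have h3 : qpdf σ₀ x ^ n * qpdf σ₀ t ^ 2 * |t - x| ^ (n + 2)
          ≤ ((n + 2) / 2) ^ (n + 2) * (1 / 2 ^ B) ^ (n + 2) :=
        (hq t ht).trans (by gcongr; exact hG t ht)
      calc qpdf σ₀ x ^ n * (|t - x| ^ (n + 2) * pdf σ₀ t)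
          = cubeRatio σ₀ * (qpdf σ₀ x ^ n * qpdf σ₀ t ^ 2 * |t - x| ^ (n + 2)) * qpdf σ₀ t := by
            rw [pdf_eq hσ₀]; ring
        _ ≤ cubeRatio σ₀ * (((n + 2) / 2) ^ (n + 2) * (1 / 2 ^ B) ^ (n + 2)) * qpdf σ₀ t := by
            have := (qpdf_pos hσ₀ t).le
            gcongr
        _ = _ := by ring
  rw [integral_const_mul, integral_const_mul, setIntegral_qpdf_bin hσ₀ hk] at h2
  refine h2.trans_eq ?_
  ring

/-- The contributions of the bins to the weighted distortion are uniformly of order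
`2^(-B(p+1))`, including those of the two unbounded bins. -/
lemma cellDistortion_le (hσ₀ : 0 < σ₀) {n B k : ℕ} (hB : B ≠ 0) (hk : k < 2 ^ B) :
    cellDistortion σ₀ (n + 2) B k
      ≤ cubeRatio σ₀ * ((n + 2) / 2) ^ (n + 2) * (1 / 2 ^ B) ^ (n + 3) := by
  have hN : (0 : ℝ) < 2 ^ B := by positivity
  have hle := fun {a b} => (strictMono_compressor hσ₀).le_iff_le (a := a) (b := b)
  -- For `B ≥ 1` the value `1/2 = G(0)` is a threshold value, so no bin has `0` in its interior and
  -- the inner endpoint is finite.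
  obtain ⟨m, rfl⟩ := Nat.exists_eq_add_one_of_ne_zero hB
  have hk' : (k : ℝ) + 1 ≤ 2 ^ (m + 1) := by exact_mod_cast hk
  rcases le_or_gt (2 ^ m) k with h | h
  · have hm : (2 : ℝ) ^ m ≤ k := by exact_mod_cast h
    have hhalf : 1 / 2 ≤ (k : ℝ) / 2 ^ (m + 1) := by
      rw [le_div_iff₀ hN, pow_succ]; linarith
    obtain ⟨x, hx⟩ := exists_compressor_eq hσ₀ (u := (k : ℝ) / 2 ^ (m + 1)) (by linarith)
      (by rw [div_lt_one hN]; linarith)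
    have hx0 : 0 ≤ x := hle.1 (by rw [compressor_zero hσ₀, hx]; exact hhalf)
    have hxt : ∀ t ∈ bin σ₀ (m + 1) k, x ≤ t := fun t ht => hle.1 (hx ▸ ht.1)
    refine cellDistortion_le_of_forall_mem_bin hσ₀ hk
      (fun t ht => abs_le_abs_of_nonneg hx0 (hxt t ht))
      (fun t ht => ?_) fun t ht => qpdf_pow_mul_abs_pow_le_of_nonneg hσ₀ n hx0 (hxt t ht)
    have h1 := ht.1
    have h2 := ht.2
    rw [add_div] at h2
    rw [hx, abs_of_nonneg (by linarith)]
    linarith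
  · have hm : (k : ℝ) + 1 ≤ 2 ^ m := by exact_mod_cast h
    have hhalf : ((k : ℝ) + 1) / 2 ^ (m + 1) ≤ 1 / 2 := by
      rw [div_le_iff₀ hN, pow_succ]; linarith
    obtain ⟨x, hx⟩ := exists_compressor_eq hσ₀ (u := ((k : ℝ) + 1) / 2 ^ (m + 1)) (by positivity)
      (by linarith)
    have hx0 : x ≤ 0 := hle.1 (by rw [compressor_zero hσ₀, hx]; exact hhalf)
    have hxt : ∀ t ∈ bin σ₀ (m + 1) k, t ≤ x := fun t ht => hle.1 (hx ▸ ht.2.le)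
    refine cellDistortion_le_of_forall_mem_bin hσ₀ hk
      (fun t ht => abs_le_abs_of_nonpos hx0 (hxt t ht))
      (fun t ht => ?_) fun t ht => qpdf_pow_mul_abs_pow_le_of_nonpos hσ₀ n hx0 (hxt t ht)
    have h1 := ht.1
    have h2 := ht.2
    rw [add_div] at h2
    rw [hx, add_div, abs_of_nonpos (by linarith)]
    linarith

/-! ### High-resolution limit of a single bin -/

lemma setIntegral_Ico_abs_sub_pow {a b x : ℝ} (h : x ∈ Set.Icc a b) (n : ℕ) :
    ∫ t in Set.Ico a b, |t - x| ^ n = ((x - a) ^ (n + 1) + (b - x) ^ (n + 1)) / (n + 1) := by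
  have hi : ∀ c d : ℝ, IntegrableOn (fun t => |t - x| ^ n) (Set.Ioc c d) := fun c d =>
    (Continuous.integrableOn_Icc (by fun_prop)).mono_set Set.Ioc_subset_Icc_self
  have h1 := integral_pow_abs_sub_uIoc (a := x) (b := b) n
  have h2 := integral_pow_abs_sub_uIoc (a := x) (b := a) n
  rw [Set.uIoc_of_le h.2, abs_of_nonneg (by linarith [h.2])] at h1
  rw [Set.uIoc_of_ge h.1, abs_sub_comm, abs_of_nonneg (by linarith [h.1])] at h2
  rw [integral_Ico_eq_integral_Ioc, ← Set.Ioc_union_Ioc_eq_Ioc h.1 h.2,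
    setIntegral_union (Set.Ioc_disjoint_Ioc_of_le le_rfl) measurableSet_Ioc (hi _ _) (hi _ _), h1, h2]
  ring

lemma continuous_pdf (hσ₀ : 0 < σ₀) : Continuous (pdf σ₀) := by
  have : pdf σ₀ = fun x => cubeRatio σ₀ * qpdf σ₀ x ^ 3 := funext (pdf_eq hσ₀)
  have := continuous_qpdf hσ₀
  rw [‹pdf σ₀ = _›]; fun_prop

/-- The point `w` is the level, `c` and `c'` are the extrema of `φ₀` on the bin, and `d` is the mean
value point with `b - a = 2^(-B) / G'(d)`. Convexity of the power shows that no `w` does better than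
the midpoint for the uniform density (lower bound), and minimality allows a comparison with the
midpoint (upper bound). The position of the level inside the bin is never needed. -/
lemma exists_cellDistortion_bounds (hσ₀ : 0 < σ₀) {n B k : ℕ} (hk : k < 2 ^ B) {a b : ℝ}
    (hab : a < b) (ha : compressor σ₀ a = k / 2 ^ B) (hb : compressor σ₀ b = (k + 1) / 2 ^ B) :
    ∃ w ∈ Set.Icc a b, ∃ c ∈ Set.Icc a b, ∃ c' ∈ Set.Icc a b, ∃ d ∈ Set.Icc a b,
      qpdf σ₀ w ^ n * pdf σ₀ c / qpdf σ₀ d ^ (n + 3) * (1 / ((n + 3) * 2 ^ (n + 2)))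
        ≤ (2 ^ B) ^ (n + 3) * cellDistortion σ₀ (n + 2) B k ∧
      (2 ^ B) ^ (n + 3) * cellDistortion σ₀ (n + 2) B k
        ≤ qpdf σ₀ w ^ n * pdf σ₀ c' / qpdf σ₀ d ^ (n + 3) * (1 / ((n + 3) * 2 ^ (n + 2))) := by
  have hN : (0 : ℝ) < 2 ^ B := by positivity
  have hle := fun {a b} => (strictMono_compressor hσ₀).le_iff_le (a := a) (b := b)
  have hlt := fun {a b} => (strictMono_compressor hσ₀).lt_iff_lt (a := a) (b := b)
  have hbin : bin σ₀ B k = Set.Ico a b := by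
    ext t
    simp only [bin, ← ha, ← hb, Set.mem_ofPred_eq, Set.mem_Ico, hle, hlt]
  obtain ⟨hmem, hmin⟩ := level_mem_bin_and_binDistortion_le hσ₀ (p := n + 2) (by omega) hk
  set w := level σ₀ (n + 2) B k with hw
  have hwab : w ∈ Set.Icc a b := Set.Ico_subset_Icc_self (hbin ▸ hmem)
  have hc := continuous_pdf hσ₀
  have hne : (Set.Icc a b).Nonempty := Set.nonempty_Icc.2 hab.le
  obtain ⟨c, hcm, hc1⟩ := isCompact_Icc.exists_isMinOn hne hc.continuousOn
  obtain ⟨c', hcm', hc2⟩ := isCompact_Icc.exists_isMaxOn hne hc.continuousOn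
  obtain ⟨d, hd, hslope⟩ := exists_compressor_sub_eq hσ₀ hab
  have hgap : qpdf σ₀ d * (b - a) = 1 / 2 ^ B := by rw [← hslope, ha, hb]; ring
  have hqd := qpdf_pos hσ₀ d
  have hNl : (2 : ℝ) ^ B * (b - a) = 1 / qpdf σ₀ d := by
    rw [eq_div_iff hqd.ne', mul_assoc, mul_comm (b - a), hgap]
    field_simp
  have hNl' : ((2 : ℝ) ^ B) ^ (n + 3) * (b - a) ^ (n + 3) = 1 / qpdf σ₀ d ^ (n + 3) := by
    rw [← mul_pow, hNl, div_pow, one_pow]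
  have hqw := pow_nonneg (qpdf_pos hσ₀ w).le n
  have hi : ∀ x : ℝ, IntegrableOn (fun t => |t - x| ^ (n + 2)) (Set.Ico a b) := fun x =>
    (Continuous.integrableOn_Icc (by fun_prop)).mono_set Set.Ico_subset_Icc_self
  have hi' : ∀ x : ℝ, IntegrableOn (fun t => |t - x| ^ (n + 2) * pdf σ₀ t) (Set.Ico a b) :=
    fun x => (Continuous.integrableOn_Icc (by fun_prop)).mono_set Set.Ico_subset_Icc_self
  have hlow : (b - a) ^ (n + 3) / ((n + 3) * 2 ^ (n + 2)) * pdf σ₀ c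
      ≤ binDistortion σ₀ (n + 2) B k w := by
    have h1 : (b - a) ^ (n + 3) / ((n + 3) * 2 ^ (n + 2))
        ≤ ∫ t in Set.Ico a b, |t - w| ^ (n + 2) := by
      rw [setIntegral_Ico_abs_sub_pow hwab]
      have h2 := add_pow_le (sub_nonneg.2 hwab.1) (sub_nonneg.2 hwab.2) (n + 3)
      rw [show w - a + (b - w) = b - a by ring, show n + 3 - 1 = n + 2 by omega] at h2
      push_cast
      rw [show (n : ℝ) + 2 + 1 = n + 3 by ring, div_le_div_iff₀ (by positivity) (by positivity)]
      calc (b - a) ^ (n + 3) * (n + 3 : ℝ) ≤ _ :=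
            mul_le_mul_of_nonneg_right h2 (by positivity)
        _ = _ := by ring
    rw [binDistortion, hbin]
    refine (mul_le_mul_of_nonneg_right h1 (pdf_nonneg σ₀ c)).trans ?_
    rw [← integral_mul_const]
    refine setIntegral_mono_on ((hi w).mul_const _) (hi' w) measurableSet_Ico fun t ht => ?_
    exact mul_le_mul_of_nonneg_left (hc1 (Set.Ico_subset_Icc_self ht)) (by positivity)
  have hup : binDistortion σ₀ (n + 2) B k w
      ≤ (b - a) ^ (n + 3) / ((n + 3) * 2 ^ (n + 2)) * pdf σ₀ c' := by
    refine (hmin ((a + b) / 2)).trans ?_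
    have h1 : ∫ t in Set.Ico a b, |t - (a + b) / 2| ^ (n + 2)
        = (b - a) ^ (n + 3) / ((n + 3) * 2 ^ (n + 2)) := by
      rw [setIntegral_Ico_abs_sub_pow ⟨by linarith, by linarith⟩,
        show (a + b) / 2 - a = (b - a) / 2 by ring, show b - (a + b) / 2 = (b - a) / 2 by ring,
        div_pow]
      push_cast
      field_simp
      ring
    rw [binDistortion, hbin, ← h1, ← integral_mul_const]
    refine setIntegral_mono_on (hi' _) ((hi _).mul_const _) measurableSet_Ico fun t ht => ?_
    exact mul_le_mul_of_nonneg_left (hc2 (Set.Ico_subset_Icc_self ht)) (by positivity)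
  have hcell : cellDistortion σ₀ (n + 2) B k
      = qpdf σ₀ w ^ n * binDistortion σ₀ (n + 2) B k w := rfl
  have hform : ∀ y : ℝ, qpdf σ₀ w ^ n * y / qpdf σ₀ d ^ (n + 3) * (1 / ((n + 3) * 2 ^ (n + 2)))
      = (2 ^ B) ^ (n + 3) * (qpdf σ₀ w ^ n *
        ((b - a) ^ (n + 3) / ((n + 3) * 2 ^ (n + 2)) * y)) := by
    intro y
    calc _ = qpdf σ₀ w ^ n * y * (1 / qpdf σ₀ d ^ (n + 3)) * (1 / ((n + 3) * 2 ^ (n + 2))) := by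
          ring
      _ = _ := by rw [← hNl']; ring
  refine ⟨w, hwab, c, hcm, c', hcm', d, Set.Ioo_subset_Icc_self hd, ?_, ?_⟩
  · rw [hform, hcell]; gcongr
  · rw [hform, hcell]; gcongr

/-- The index of the bin that contains `t`. -/
noncomputable def binIndex (σ₀ : ℝ≥0) (B : ℕ) (t : ℝ) : ℕ := ⌊compressor σ₀ t * 2 ^ B⌋₊

lemma binIndex_lt (hσ₀ : 0 < σ₀) (B : ℕ) (t : ℝ) : binIndex σ₀ B t < 2 ^ B := by
  rw [binIndex, Nat.floor_lt (mul_nonneg (compressor_pos hσ₀ t).le (by positivity))]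
  push_cast
  exact mul_lt_of_lt_one_left (by positivity) (compressor_lt_one hσ₀ t)

lemma mem_bin_iff (hσ₀ : 0 < σ₀) {B k : ℕ} {t : ℝ} : t ∈ bin σ₀ B k ↔ binIndex σ₀ B t = k := by
  rw [binIndex, Nat.floor_eq_iff (mul_nonneg (compressor_pos hσ₀ t).le (by positivity))]
  have : (0 : ℝ) < 2 ^ B := by positivity
  rw [bin, Set.mem_ofPred_eq, div_le_iff₀ this, lt_div_iff₀ this]

/-- High-resolution asymptotics: asymptotically all bins contribute equally. -/
lemma tendsto_cellDistortion_binIndex (hσ₀ : 0 < σ₀) (n : ℕ) (t : ℝ) :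
    Tendsto (fun B => ((2 : ℝ) ^ B) ^ (n + 3) * cellDistortion σ₀ (n + 2) B (binIndex σ₀ B t))
      atTop (𝓝 (cubeRatio σ₀ * (1 / ((n + 3) * 2 ^ (n + 2))))) := by
  let Φ : ℝ × ℝ × ℝ → ℝ := fun y => qpdf σ₀ y.1 ^ n * pdf σ₀ y.2.1 / qpdf σ₀ y.2.2 ^ (n + 3)
    * (1 / ((n + 3) * 2 ^ (n + 2)))
  have hΦ : Continuous Φ := by
    have h1 := continuous_pdf hσ₀
    have h2 := continuous_qpdf hσ₀
    refine Continuous.mul (Continuous.div (by fun_prop) (by fun_prop) fun y => ?_) (by fun_prop)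
    exact (pow_pos (qpdf_pos hσ₀ _) _).ne'
  have hΦt : Φ (t, t, t) = cubeRatio σ₀ * (1 / ((n + 3) * 2 ^ (n + 2))) := by
    have := (qpdf_pos hσ₀ t).ne'
    simp only [Φ, pdf_eq hσ₀]
    rw [show qpdf σ₀ t ^ n * (cubeRatio σ₀ * qpdf σ₀ t ^ 3)
      = cubeRatio σ₀ * qpdf σ₀ t ^ (n + 3) by ring, mul_div_cancel_right₀ _ (pow_ne_zero _ this)]
  rw [← hΦt, Metric.tendsto_nhds]
  intro ε hε
  obtain ⟨δ, hδ, hball⟩ := Metric.continuousAt_iff.1 (hΦ.continuousAt (x := (t, t, t))) ε hε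
  have hmono := strictMono_compressor hσ₀
  have hpow : Tendsto (fun B : ℕ => (1 : ℝ) / 2 ^ B) atTop (𝓝 0) := by
    simp only [one_div]
    exact tendsto_inv_atTop_zero.comp
      (tendsto_pow_atTop_atTop_of_one_lt (r := (2 : ℝ)) (by norm_num))
  have e1 : 0 < compressor σ₀ t - compressor σ₀ (t - δ / 2) := sub_pos.2 (hmono (by linarith))
  have e2 : 0 < compressor σ₀ (t + δ / 2) - compressor σ₀ t := sub_pos.2 (hmono (by linarith))
  -- Once `2^(-B)` is below both increments of `G`, the bin of `t` is bounded and lies within `δ /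
  -- 2` of `t`.
  filter_upwards [hpow.eventually (Iio_mem_nhds e1), hpow.eventually (Iio_mem_nhds e2)]
    with B hB1 hB2
  set k := binIndex σ₀ B t with hk
  have hkN : k < 2 ^ B := binIndex_lt hσ₀ B t
  have hmem : t ∈ bin σ₀ B k := (mem_bin_iff hσ₀).2 hk.symm
  have m1 := hmem.1
  have m2 := hmem.2
  have hadd : ((k : ℝ) + 1) / 2 ^ B = k / 2 ^ B + 1 / 2 ^ B := add_div _ _ _
  have p1 := compressor_pos hσ₀ (t - δ / 2)
  have p2 := compressor_lt_one hσ₀ (t + δ / 2)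
  obtain ⟨a, ha⟩ := exists_compressor_eq hσ₀ (u := (k : ℝ) / 2 ^ B) (by linarith)
    (by linarith [compressor_lt_one hσ₀ t])
  obtain ⟨b, hb⟩ := exists_compressor_eq hσ₀ (u := ((k : ℝ) + 1) / 2 ^ B) (by positivity)
    (by linarith)
  have hab : a < b := hmono.lt_iff_lt.1 (by linarith [ha, hb])
  have ha' : t - δ / 2 < a := hmono.lt_iff_lt.1 (by linarith)
  have hb' : b < t + δ / 2 := hmono.lt_iff_lt.1 (by linarith)
  have hdist : ∀ x ∈ Set.Icc a b, dist x t < δ := fun x hx => by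
    rw [Real.dist_eq, abs_lt]; constructor <;> linarith [hx.1, hx.2]
  obtain ⟨w, hw, c, hc, c', hc', d, hd, hlow, hup⟩ :=
    exists_cellDistortion_bounds hσ₀ (n := n) hkN hab ha hb
  have b1 := hball (x := (w, c, d)) (by
    simp only [Prod.dist_eq, max_lt_iff]; exact ⟨hdist w hw, hdist c hc, hdist d hd⟩)
  have b2 := hball (x := (w, c', d)) (by
    simp only [Prod.dist_eq, max_lt_iff]; exact ⟨hdist w hw, hdist c' hc', hdist d hd⟩)
  rw [Real.dist_eq, abs_lt] at b1 b2 ⊢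
  exact ⟨b1.1.trans_le (sub_le_sub_right hlow _), (sub_le_sub_right hup _).trans_lt b2.2⟩

/-! ### Summation over the bins -/

lemma sum_indicator_bin (hσ₀ : 0 < σ₀) (B : ℕ) (f : ℕ → ℝ → ℝ) (t : ℝ) :
    ∑ k ∈ Finset.range (2 ^ B), (bin σ₀ B k).indicator (f k) t = f (binIndex σ₀ B t) t := by
  rw [Finset.sum_eq_single (binIndex σ₀ B t)]
  · exact Set.indicator_of_mem ((mem_bin_iff hσ₀).2 rfl) _
  · intro k _ hk
    exact Set.indicator_of_notMem (fun h => hk ((mem_bin_iff hσ₀).1 h).symm) _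
  · intro h
    exact absurd (Finset.mem_range.2 (binIndex_lt hσ₀ B t)) h

lemma quantizer_eq (hσ₀ : 0 < σ₀) (p B : ℕ) (t : ℝ) :
    quantizer σ₀ p B t = level σ₀ p B (binIndex σ₀ B t) :=
  sum_indicator_bin hσ₀ B (fun k _ => level σ₀ p B k) t

lemma integral_binIndex (hσ₀ : 0 < σ₀) (B : ℕ) {f : ℕ → ℝ → ℝ} {μ : Measure ℝ}
    (hf : ∀ k, Integrable (f k) μ) :
    Integrable (fun t => f (binIndex σ₀ B t) t) μ ∧
      ∫ t, f (binIndex σ₀ B t) t ∂μ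
        = ∑ k ∈ Finset.range (2 ^ B), ∫ t in bin σ₀ B k, f k t ∂μ := by
  simp_rw [← sum_indicator_bin hσ₀ B f]
  have hi : ∀ k ∈ Finset.range (2 ^ B),
      Integrable (fun t => (bin σ₀ B k).indicator (f k) t) μ :=
    fun k _ => (hf k).indicator (measurableSet_bin hσ₀ B k)
  refine ⟨integrable_finsetSum _ hi, ?_⟩
  rw [integral_finsetSum _ hi]
  exact Finset.sum_congr rfl fun k _ => integral_indicator (measurableSet_bin hσ₀ B k)

lemma measurable_binIndex (hσ₀ : 0 < σ₀) (B : ℕ) : Measurable (binIndex σ₀ B) :=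
  Nat.measurable_floor.comp ((continuous_compressor hσ₀).measurable.mul_const _)

lemma gaussianReal_real_bin (hσ₀ : 0 < σ₀) {B k : ℕ} (hk : k < 2 ^ B) :
    (gaussianReal 0 (3 * σ₀ ^ 2)).real (bin σ₀ B k) = 1 / 2 ^ B := by
  have h := setIntegral_gaussianReal (three_mul_sq_ne_zero hσ₀) (measurableSet_bin hσ₀ B k)
    fun _ => (1 : ℝ)
  rw [← qpdf_eq hσ₀] at h
  simpa [setIntegral_qpdf_bin hσ₀ hk] using h

/-- The `ν`-mass `2^(-B)` of each bin absorbs one power of `2^B`, which turns the sum into the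
`ν`-integral of the rescaled contribution of the bin of `t`. -/
lemma tendsto_sum_cellDistortion (hσ₀ : 0 < σ₀) (n : ℕ) :
    Tendsto (fun B => ((2 : ℝ) ^ B) ^ (n + 2)
        * ∑ k ∈ Finset.range (2 ^ B), cellDistortion σ₀ (n + 2) B k)
      atTop (𝓝 (cubeRatio σ₀ * (1 / ((n + 3) * 2 ^ (n + 2))))) := by
  set ν := gaussianReal 0 (3 * σ₀ ^ 2)
  set C := cubeRatio σ₀ * ((n + 2) / 2) ^ (n + 2)
  let F : ℕ → ℝ → ℝ :=
    fun B t => ((2 : ℝ) ^ B) ^ (n + 3) * cellDistortion σ₀ (n + 2) B (binIndex σ₀ B t)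
  have hF : ∀ B, ∫ t, F B t ∂ν = ((2 : ℝ) ^ B) ^ (n + 2)
        * ∑ k ∈ Finset.range (2 ^ B), cellDistortion σ₀ (n + 2) B k := by
    intro B
    rw [(integral_binIndex hσ₀ B (μ := ν)
      (f := fun k _ => ((2 : ℝ) ^ B) ^ (n + 3) * cellDistortion σ₀ (n + 2) B k)
      fun k => integrable_const _).2, Finset.mul_sum]
    refine Finset.sum_congr rfl fun k hk => ?_
    rw [setIntegral_const, gaussianReal_real_bin hσ₀ (Finset.mem_range.1 hk), smul_eq_mul]
    field_simp
    ring
  -- The shift to `B + 1` avoids `B = 0`, where the uniform bound is not available.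
  have hlim : Tendsto (fun B => ∫ t, F (B + 1) t ∂ν) atTop
      (𝓝 (∫ _, cubeRatio σ₀ * (1 / ((n + 3) * 2 ^ (n + 2))) ∂ν)) := by
    refine tendsto_integral_of_dominated_convergence (fun _ => C) (fun B => ?_)
      (integrable_const _) (fun B => .of_forall fun t => ?_) (.of_forall fun t => ?_)
    · exact (((Measurable.of_discrete (f := cellDistortion σ₀ (n + 2) (B + 1))).comp
        (measurable_binIndex hσ₀ (B + 1))).const_mul _).aestronglyMeasurable
    · rw [Real.norm_of_nonneg (mul_nonneg (by positivity) (cellDistortion_nonneg hσ₀ _ _ _))]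
      have := cellDistortion_le hσ₀ (n := n) (by omega) (binIndex_lt hσ₀ (B + 1) t)
      refine (mul_le_mul_of_nonneg_left this (by positivity)).trans_eq ?_
      rw [mul_left_comm, ← mul_pow, mul_one_div_cancel (by positivity), one_pow, mul_one]
    · exact (tendsto_cellDistortion_binIndex hσ₀ n t).comp (tendsto_add_atTop_nat 1)
  rw [← tendsto_add_atTop_iff_nat 1]
  simpa [hF] using hlim

/-! ### The strong law for a fixed number of bits -/

/-- The contribution of a single coordinate `t` to the weighted distortion. -/
noncomputable def pointDistortion (σ₀ : ℝ≥0) (p B : ℕ) (t : ℝ) : ℝ :=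
  qpdf σ₀ (quantizer σ₀ p B t) ^ (p - 2) * |t - quantizer σ₀ p B t| ^ p

/-- The `p`-th power turns the weight exponent `(p-2)/p` into the natural number `p - 2`; `2 ≤ p`
makes the truncated subtraction exact. -/
lemma weightedDistortion_eq_sum (hσ₀ : 0 < σ₀) {p : ℕ} (hp : 2 ≤ p) (B : ℕ) {M : ℕ}
    (z : Fin M → ℝ) :
    weightedDistortion σ₀ p B z = ∑ i, pointDistortion σ₀ p B (z i) := by
  have hp0 : p ≠ 0 := by omega
  have hp1 : (p : ℝ) ≠ 0 := by exact_mod_cast hp0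
  rw [weightedDistortion, weightedNorm, PiLp.norm_eq_sum (by simp; omega)]
  simp only [ENNReal.toReal_natCast, Real.rpow_natCast]
  rw [one_div, Real.rpow_inv_natCast_pow (Finset.sum_nonneg fun i _ => by positivity) hp0]
  refine Finset.sum_congr rfl fun i _ => ?_
  have hq := qpdf_pos hσ₀ (quantizer σ₀ p B (z i))
  rw [Real.norm_eq_abs, abs_mul, mul_pow, abs_sub_comm, weights, pointDistortion,
    abs_of_nonneg (Real.rpow_nonneg hq.le _), ← Real.rpow_natCast (_ ^ _), ← Real.rpow_mul hq.le,
    div_mul_cancel₀ _ hp1, ← Real.rpow_natCast _ (p - 2), Nat.cast_sub hp]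
  rfl

lemma pointDistortion_eq (hσ₀ : 0 < σ₀) (p B : ℕ) :
    pointDistortion σ₀ p B = fun t =>
      (fun k t => qpdf σ₀ (level σ₀ p B k) ^ (p - 2) * |t - level σ₀ p B k| ^ p)
        (binIndex σ₀ B t) t := by
  ext t
  simp only [pointDistortion, quantizer_eq hσ₀]

lemma integral_pointDistortion (hσ₀ : 0 < σ₀) (p B : ℕ) :
    Integrable (pointDistortion σ₀ p B) (gaussianReal 0 (σ₀ ^ 2)) ∧
    ∫ t, pointDistortion σ₀ p B t ∂gaussianReal 0 (σ₀ ^ 2)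
      = ∑ k ∈ Finset.range (2 ^ B), cellDistortion σ₀ p B k := by
  have h := integral_binIndex hσ₀ B (μ := gaussianReal 0 (σ₀ ^ 2))
    (f := fun k t => qpdf σ₀ (level σ₀ p B k) ^ (p - 2) * |t - level σ₀ p B k| ^ p)
    fun k => (integrable_abs_sub_pow (integrable_abs_pow_gaussianReal _) _ _).const_mul _
  rw [pointDistortion_eq hσ₀]
  refine ⟨h.1, h.2.trans (Finset.sum_congr rfl fun k _ => ?_)⟩
  rw [integral_const_mul, cellDistortion, binDistortion_eq hσ₀]

lemma measurable_quantizer (hσ₀ : 0 < σ₀) (p B : ℕ) : Measurable (quantizer σ₀ p B) :=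
  Finset.measurable_fun_sum _ fun k _ => measurable_const.indicator (measurableSet_bin hσ₀ B k)

lemma measurable_pointDistortion (hσ₀ : 0 < σ₀) (p B : ℕ) :
    Measurable (pointDistortion σ₀ p B) := by
  have h1 := measurable_quantizer hσ₀ p B
  have h2 := (continuous_qpdf hσ₀).measurable.comp h1
  exact (h2.pow_const _).mul ((measurable_norm.comp (measurable_id.sub h1)).pow_const p)

lemma ae_tendsto_weightedDistortion_div {Ω : Type*} [MeasurableSpace Ω] {P : Measure Ω}
    [IsProbabilityMeasure P] (hσ₀ : 0 < σ₀) {p : ℕ} (hp : 2 ≤ p) {z : ℕ → Ω → ℝ}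
    (hlaw : ∀ i, HasLaw (z i) (gaussianReal 0 (σ₀ ^ 2)) P) (hindep : iIndepFun z P) (B : ℕ) :
    ∀ᵐ ω ∂P, Tendsto (fun M : ℕ => weightedDistortion σ₀ p B (fun i : Fin M => z i ω) / M) atTop
      (𝓝 (∑ k ∈ Finset.range (2 ^ B), cellDistortion σ₀ p B k)) := by
  have hm := measurable_pointDistortion hσ₀ p B
  obtain ⟨hi, hint⟩ := integral_pointDistortion hσ₀ p B
  have hX0 : ∫ ω, pointDistortion σ₀ p B (z 0 ω) ∂P
      = ∑ k ∈ Finset.range (2 ^ B), cellDistortion σ₀ p B k := by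
    rw [← hint]; exact (hlaw 0).integral_comp hm.aestronglyMeasurable
  have hX : Integrable (pointDistortion σ₀ p B ∘ z 0) P :=
    (integrable_map_measure (by rw [(hlaw 0).map_eq]; exact hm.aestronglyMeasurable)
      (hlaw 0).aemeasurable).1 (by rw [(hlaw 0).map_eq]; exact hi)
  have hslln := strong_law_ae_real (μ := P) (fun i ω => pointDistortion σ₀ p B (z i ω))
    hX (fun i j hij => (hindep.indepFun hij).comp hm hm)
    fun i => ((hlaw i).identDistrib (hlaw 0)).comp hm
  filter_upwards [hslln] with ω hω
  rw [hX0] at hω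
  refine hω.congr fun M => ?_
  rw [weightedDistortion_eq_sum hσ₀ hp, ← Fin.sum_univ_eq_sum_range
    (fun i => pointDistortion σ₀ p B (z i ω))]

end GaussianQuantization

theorem lemma3 {Ω : Type*} [MeasurableSpace Ω] (P : Measure Ω) [IsProbabilityMeasure P]
    (σ₀ : ℝ≥0) (hσ₀ : 0 < σ₀) (p : ℕ) (hp : 2 ≤ p) (z : ℕ → Ω → ℝ)
    (hlaw : ∀ i, HasLaw (z i) (gaussianReal 0 (σ₀ ^ 2)) P) (hindep : iIndepFun z P) :
    (∃ r : ℕ → ℝ, Tendsto r atTop (𝓝 1) ∧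
      ∀ᵐ ω ∂P, ∀ B : ℕ, Tendsto
        (fun M : ℕ =>
          GaussianQuantization.weightedDistortion σ₀ p B (fun i : Fin M => z i ω) /
            (M * ((2 : ℝ) ^ (-((B : ℝ) * p)) / ((p + 1) * 2 ^ p)) *
              GaussianQuantization.fnorm (1 / 3) (GaussianQuantization.pdf σ₀)))
        atTop (𝓝 (r B))) ∧
    GaussianQuantization.fnorm (1 / 3) (GaussianQuantization.pdf σ₀) =
      2 * Real.pi * (σ₀ : ℝ) ^ 2 * (3 : ℝ) ^ (3 / 2 : ℝ) := by
  open GaussianQuantization in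
  refine ⟨?_, fnorm_pdf hσ₀⟩
  rw [fnorm_pdf hσ₀]
  -- The value `r B` is the expected distortion of one coordinate divided by its predicted value.
  refine ⟨fun B => (∑ k ∈ Finset.range (2 ^ B), cellDistortion σ₀ p B k) /
    ((2 : ℝ) ^ (-((B : ℝ) * p)) / ((p + 1) * 2 ^ p) * cubeRatio σ₀), ?_, ?_⟩
  · obtain ⟨n, rfl⟩ := Nat.exists_eq_add_of_le' hp
    have hA := cubeRatio_pos hσ₀
    have hA' : cubeRatio σ₀ * (1 / ((n + 3) * 2 ^ (n + 2))) ≠ 0 := by positivity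
    have h := (tendsto_sum_cellDistortion hσ₀ n).div_const
      (cubeRatio σ₀ * (1 / ((n + 3) * 2 ^ (n + 2))))
    rw [div_self hA'] at h
    refine h.congr fun B => ?_
    have e : (2 : ℝ) ^ (-((B : ℝ) * (n + 2 : ℕ))) = ((2 ^ B) ^ (n + 2))⁻¹ := by
      rw [Real.rpow_neg (by norm_num), ← pow_mul, ← Real.rpow_natCast]
      push_cast; rfl
    rw [e]
    push_cast
    field_simp
    ring
  -- There are countably many `B`, so one null set serves them all.
  · rw [ae_all_iff]
    intro B
    filter_upwards [ae_tendsto_weightedDistortion_div hσ₀ hp hlaw hindep B] with ω hω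
    refine (hω.div_const _).congr fun M => ?_
    rw [div_div, mul_assoc]
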